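/- Let $p$ be a prime, let $q$ be a square power of $p$, and let $\mathbb F_q$ be the field with $q$ elements. A point set $S\subseteq \mathrm{PG}(2,q)$ is called $1$-saturating if every point of $\mathrm{PG}(2,q)$ (in homogeneous coordinates) is a linear combination of at most two points of $S$, and this fails with "two" replaced by "one" (that is, $S$ is not the whole plane). A point set of a projective plane is a double blocking set if every line of the plane contains at least two of its points. Write $\mathrm{PG}(2,\sqrt q)\subset \mathrm{PG}(2,q)$ for the Baer subplane of points having homogeneous coordinates in the subfield $\mathbb F_{\sqrt q}$ of $\mathbb F_q$, and, when $\sqrt q$ is not prime, write $\phi(\sqrt q)$ for the order of the largest proper subfield of $\mathbb F_{\sqrt q}$. Then in $\mathrm{PG}(2,q)$ there exist $1$-saturating sets, each of which is moreover a double blocking set of the Baer subplane $\mathrm{PG}(2,\sqrt q)$, of exactly the following sizes: (iv) $2\sqrt q+2\sqrt[3]{q}+2\sqrt[6]{q}+2$, if $q=p^{6h}$ with $h\ge 1$ and $p^h\equiv 2 \pmod 7$; (v) $2\sqrt q+2\,\dfrac{\sqrt q-1}{\phi(\sqrt q)-1}$, if $q=p^{2h}$ with $h\ge2$ and $p\ge3$;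 (vi) $2\sqrt q+2\,\dfrac{\sqrt q}{p}+2$, if $q=p^{2h}$ with $h\ge2$ and $p\ge7$. -/

import Mathlib

open scoped LinearAlgebra.Projectivization

/-- A point set `S` of `PG(V)` covers it with parameter `ρ`: every point, in homogeneous
coordinates, is a linear combination of at most `ρ + 1` points of `S`. -/
def CoversWith {F V : Type*} [Field F] [AddCommGroup V] [Module F V]
    (ρ : ℕ) (S : Set (ℙ F V)) : Prop :=
  ∀ A : ℙ F V, ∃ T : Set (ℙ F V), T ⊆ S ∧ T.encard ≤ ((ρ + 1 : ℕ) : ℕ∞) ∧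
    A.submodule ≤ ⨆ P ∈ T, P.submodule

/-- `S` is `ρ`-saturating: it covers with parameter `ρ`, and `ρ` is the smallest such value. -/
def IsSaturating {F V : Type*} [Field F] [AddCommGroup V] [Module F V]
    (ρ : ℕ) (S : Set (ℙ F V)) : Prop :=
  IsLeast {k : ℕ | CoversWith k S} ρ

/-- A double blocking set of the projective plane `PG(2, K)`: every line (two-dimensional subspace
of `K³`) contains at least two points of `B`. -/
def IsDoubleBlocking {K : Type*} [Field K] (B : Set (ℙ K (Fin 3 → K))) : Prop :=
  ∀ W : Submodule K (Fin 3 → K), Module.finrank K W = 2 →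
    2 ≤ {P : ℙ K (Fin 3 → K) | P ∈ B ∧ P.submodule ≤ W}.encard

/-- The coordinatewise inclusion `K³ → F³` for a subfield `K` of `F`. -/
def coordIncl {F : Type*} [Field F] (K : Subfield F) :
    (Fin 3 → K) →ₛₗ[K.subtype] (Fin 3 → F) where
  toFun v := fun i => (v i : F)
  map_add' _ _ := rfl
  map_smul' _ _ := rfl

theorem coordIncl_injective {F : Type*} [Field F] (K : Subfield F) :
    Function.Injective (coordIncl K) := by
  intro v w h
  funext i
  exact Subtype.ext (congrFun h i)

/-- The inclusion of `PG(2, K)` into `PG(2, F)` as a subplane: the points which have homogeneous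
coordinates in the subfield `K`. It is a Baer subplane if `|F| = |K|²`. -/
def subplaneIncl {F : Type*} [Field F] (K : Subfield F) :
    ℙ K (Fin 3 → K) → ℙ F (Fin 3 → F) :=
  Projectivization.map (coordIncl K) (coordIncl_injective K)

/-- The order `φ` of the largest proper subfield of a finite field `K` (used only for fields
which have a proper subfield, that is, fields of non-prime order). -/
noncomputable def largestProperSubfieldOrder (K : Type*) [Field K] : ℕ :=
  sSup {n : ℕ | ∃ L : Subfield K, L ≠ ⊤ ∧ Nat.card L = n}

/-! Write K for the subfield of order √q. As F = K ⊕ ωK, every vector of F³ is a + ωb with a, b in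
K³. A K-line through a and b carries two points of a double blocking set, and these span it, so
`IsDoubleBlocking.isSaturating_image` gives 1-saturation.

A double blocking set arises as two disjoint blocking sets: the Rédei-type set of an additive f, of
size |K| plus the number of values f(x)/x, and a collineation image of it
(`isDoubleBlocking_redeiSet_union`, `ncard_redeiSet_union`). The real work is choosing the
collineation so that the two are disjoint.

For (iv) and (v), f is x ↦ x^r with r the order of a proper subfield, giving (|K| - 1)/(r - 1)
directions; disjointness reduces to a map not permuting Kˣ, shown by power sums
(`exists_forall_mul_ne`). For (vi), f is the trace to the prime field, giving |K|/p + 1 directions;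
disjointness reduces to a fixed-point-free map on the prime field (`exists_trace_div_ne`). -/

/-! ### Rédei-type blocking sets and disjoint unions of two of them -/

/-- The Rédei-type point set of the graph of an additive function: its affine points
`(x : f x : 1)` together with the directions `(x : f x : 0)`. -/
def redeiSet {K : Type*} [Field K] (f : K →+ K) : Set (ℙ K (Fin 3 → K)) :=
  Set.range (fun x : K => Projectivization.mk K ![x, f x, 1]
    (fun h => one_ne_zero (congrFun h 2))) ∪
  Set.range (fun x : Kˣ => Projectivization.mk K ![(x : K), f x, 0]
    (fun h => x.ne_zero (congrFun h 0)))

/-- Every line contains a point of a Rédei-type set over a finite field. -/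
theorem exists_mem_redeiSet_le_ker {K : Type*} [Field K] [Finite K] (f : K →+ K)
    (φ : (Fin 3 → K) →ₗ[K] K) : ∃ P ∈ redeiSet f, P.submodule ≤ LinearMap.ker φ := by
  let g : K →+ K :=
    { toFun := fun x => φ ![x, f x, 0]
      map_zero' := by
        have : (![0, f 0, 0] : Fin 3 → K) = 0 := by ext i; fin_cases i <;> simp
        rw [this, map_zero]
      map_add' := fun x y => by
        rw [← map_add]; congr 1; ext i; fin_cases i <;> simp }
  -- By finiteness an injective `g` is onto and yields an affine point on the line; otherwise a
  -- nonzero kernel element of `g` yields a direction on it.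
  by_cases hg : Function.Injective g
  · obtain ⟨x, hx⟩ := Finite.surjective_of_injective hg (-φ ![0, 0, 1])
    refine ⟨_, Or.inl ⟨x, rfl⟩, ?_⟩
    rw [Projectivization.submodule_mk, Submodule.span_singleton_le_iff_mem, LinearMap.mem_ker]
    have : (![x, f x, 1] : Fin 3 → K) = ![x, f x, 0] + ![0, 0, 1] := by
      ext i; fin_cases i <;> simp
    rw [this, map_add]
    change g x + _ = 0
    rw [hx, neg_add_cancel]
  · rw [injective_iff_map_eq_zero] at hg
    push Not at hg
    obtain ⟨x, hx, hx0⟩ := hg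
    refine ⟨_, Or.inr ⟨Units.mk0 x hx0, rfl⟩, ?_⟩
    rw [Projectivization.submodule_mk, Submodule.span_singleton_le_iff_mem, LinearMap.mem_ker]
    exact hx

theorem finrank_ker_eq_two {K : Type*} [Field K] {φ : (Fin 3 → K) →ₗ[K] K} (hφ : φ ≠ 0) :
    Module.finrank K (LinearMap.ker φ) = 2 := by
  have h1 := LinearMap.finrank_range_add_finrank_ker φ
  rw [LinearMap.range_eq_top.2 (LinearMap.surjective hφ), finrank_top, Module.finrank_self,
    Module.finrank_fin_fun] at h1
  omega

theorem exists_le_ker_of_finrank_le_two {K : Type*} [Field K] (W : Submodule K (Fin 3 → K))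
    (hW : Module.finrank K W ≤ 2) : ∃ φ : (Fin 3 → K) →ₗ[K] K, φ ≠ 0 ∧ W ≤ LinearMap.ker φ := by
  refine Submodule.exists_le_ker_of_lt_top W (lt_top_iff_ne_top.2 ?_)
  rintro rfl
  rw [finrank_top, Module.finrank_fin_fun] at hW
  omega

theorem exists_eq_ker_of_finrank_eq_two {K : Type*} [Field K] (W : Submodule K (Fin 3 → K))
    (hW : Module.finrank K W = 2) : ∃ φ : (Fin 3 → K) →ₗ[K] K, W = LinearMap.ker φ := by
  obtain ⟨φ, hφ, hle⟩ := exists_le_ker_of_finrank_le_two W hW.le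
  exact ⟨φ, Submodule.eq_of_le_of_finrank_eq hle (hW.trans (finrank_ker_eq_two hφ).symm)⟩

theorem Projectivization.submodule_map_le_iff {K V W : Type*} [Field K] [AddCommGroup V]
    [Module K V] [AddCommGroup W] [Module K W] (M : V →ₗ[K] W) (hM : Function.Injective M)
    (P : ℙ K V) (U : Submodule K W) :
    (Projectivization.map M hM P).submodule ≤ U ↔ P.submodule ≤ U.comap M := by
  induction P with
  | h v hv =>
    rw [Projectivization.map_mk, Projectivization.submodule_mk, Projectivization.submodule_mk,
      Submodule.span_singleton_le_iff_mem, Submodule.span_singleton_le_iff_mem,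
      Submodule.mem_comap]

/-- The union of a Rédei-type set with a disjoint collineation image of it is double blocking. -/
theorem isDoubleBlocking_redeiSet_union {K : Type*} [Field K] [Finite K] (f : K →+ K)
    (M : (Fin 3 → K) →ₗ[K] (Fin 3 → K)) (hM : Function.Injective M)
    (hd : Disjoint (redeiSet f) (Projectivization.map M hM '' redeiSet f)) :
    IsDoubleBlocking (redeiSet f ∪ Projectivization.map M hM '' redeiSet f) := by
  intro W hW
  obtain ⟨φ, rfl⟩ := exists_eq_ker_of_finrank_eq_two W hW
  obtain ⟨P, hP, hPφ⟩ := exists_mem_redeiSet_le_ker f φ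
  obtain ⟨Q, hQ, hQφ⟩ := exists_mem_redeiSet_le_ker f (φ ∘ₗ M)
  have hQ' : Projectivization.map M hM Q ∈ Projectivization.map M hM '' redeiSet f :=
    Set.mem_image_of_mem _ hQ
  have hne : P ≠ Projectivization.map M hM Q := fun h =>
    Set.disjoint_left.1 hd hP (h ▸ hQ')
  rw [← Set.encard_pair hne]
  refine Set.encard_le_encard ?_
  rintro _ (rfl | rfl)
  · exact ⟨Or.inl hP, hPφ⟩
  · exact ⟨Or.inr hQ', (Projectivization.submodule_map_le_iff _ _ _ _).2 hQφ⟩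

theorem ncard_redeiSet {K : Type*} [Field K] [Finite K] (f : K →+ K) :
    (redeiSet f).ncard = Nat.card K + (Set.range fun x : Kˣ => f x / (x : K)).ncard := by
  have hdis : Disjoint
      (Set.range (fun x : K => Projectivization.mk K ![x, f x, 1]
        (fun h => one_ne_zero (congrFun h 2))))
      (Set.range (fun x : Kˣ => Projectivization.mk K ![(x : K), f x, 0]
        (fun h => x.ne_zero (congrFun h 0)))) := by
    rw [Set.disjoint_left]
    rintro _ ⟨x, rfl⟩ ⟨y, h⟩
    obtain ⟨a, ha⟩ := (Projectivization.mk_eq_mk_iff' K _ _ _ _).1 h.symm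
    simpa using congrFun ha 2
  have : Finite (ℙ K (Fin 3 → K)) := Quotient.finite _
  rw [redeiSet, Set.ncard_union_eq hdis (Set.toFinite _) (Set.toFinite _)]
  congr 1
  · rw [← Set.image_univ, Set.ncard_image_of_injective, Set.ncard_univ]
    intro x y h
    obtain ⟨a, ha⟩ := (Projectivization.mk_eq_mk_iff' K _ _ _ _).1 h
    have h0 := congrFun ha 0
    have h2 := congrFun ha 2
    simp at h0 h2
    rw [← h0, h2, one_mul]
  -- Directions are counted by slope: (x : f x : 0) = (1 : f x / x : 0).
  · let s : K → ℙ K (Fin 3 → K) := fun m => Projectivization.mk K ![1, m, 0]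
      (fun h => one_ne_zero (congrFun h 0))
    have hs : Function.Injective s := by
      intro m m' h
      obtain ⟨a, ha⟩ := (Projectivization.mk_eq_mk_iff' K _ _ _ _).1 h
      have h0 := congrFun ha 0
      have h1 := congrFun ha 1
      simp at h0 h1
      rw [← h1, h0, one_mul]
    rw [← Set.ncard_image_of_injective _ hs, ← Set.range_comp]
    congr 2
    ext x : 1
    refine (Projectivization.mk_eq_mk_iff' K _ _ _ _).2 ⟨x, ?_⟩
    ext i
    fin_cases i <;> simp [mul_div_cancel₀]

theorem ncard_redeiSet_union {K : Type*} [Field K] [Finite K] (f : K →+ K)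
    (M : (Fin 3 → K) →ₗ[K] (Fin 3 → K)) (hM : Function.Injective M)
    (hd : Disjoint (redeiSet f) (Projectivization.map M hM '' redeiSet f)) :
    (redeiSet f ∪ Projectivization.map M hM '' redeiSet f).ncard =
      2 * (Nat.card K + (Set.range fun x : Kˣ => f x / (x : K)).ncard) := by
  have : Finite (ℙ K (Fin 3 → K)) := Quotient.finite _
  rw [Set.ncard_union_eq hd (Set.toFinite _) (Set.toFinite _),
    Set.ncard_image_of_injective _ (Projectivization.map_injective M hM), ncard_redeiSet, two_mul]

/-! ### From double blocking sets of a Baer subplane to saturating sets -/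

theorem subplaneIncl_injective {F : Type*} [Field F] (K : Subfield F) :
    Function.Injective (subplaneIncl K) := by
  intro P Q h
  induction P with
  | h u hu =>
  induction Q with
  | h v hv =>
    obtain ⟨a, ha⟩ := (Projectivization.mk_eq_mk_iff' F _ _ _ _).1 h
    have ha' : ∀ i, a * (v i : F) = u i := fun i => congrFun ha i
    obtain ⟨i, hi⟩ := Function.ne_iff.1 hv
    have hi' : (v i : F) ≠ 0 := fun h => hi (Subtype.ext h)
    refine (Projectivization.mk_eq_mk_iff' K _ _ _ _).2 ⟨u i / v i, ?_⟩
    ext j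
    simp only [Pi.smul_apply, smul_eq_mul, Subfield.coe_mul, Subfield.coe_div]
    rw [← ha' i, mul_div_cancel_right₀ _ hi', ha' j]

/-- A double blocking set of a Baer subplane is `1`-saturating in the whole plane. -/
theorem IsDoubleBlocking.isSaturating_image {F : Type*} [Field F] [Finite F] {K : Subfield F}
    (hK : Nat.card K ^ 2 = Nat.card F) {B : Set (ℙ K (Fin 3 → K))} (hB : IsDoubleBlocking B) :
    IsSaturating 1 (subplaneIncl K '' B) := by
  have hfr : Module.finrank K F = 2 := by
    have h := Module.natCard_eq_pow_finrank (K := K) (V := F)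
    rw [← hK] at h
    exact (Nat.pow_right_injective (Finite.one_lt_card (α := K)) h).symm
  have hKtop : ∃ ω : F, ω ∉ K := by
    by_contra! h
    have : K = ⊤ := by ext x; simp [h x]
    subst this
    have h1 := Finite.one_lt_card (α := F)
    rw [Nat.card_congr (Subfield.topEquiv (K := F)).toEquiv] at hK
    nlinarith
  obtain ⟨ω, hω⟩ := hKtop
  -- 1 and ω are independent over K, and |K × K| = |F| turns injectivity into surjectivity.
  have hdec : ∀ x : F, ∃ ab : K × K, (ab.1 : F) + ω * ab.2 = x := by
    have hinj : Function.Injective (fun ab : K × K => (ab.1 : F) + ω * ab.2) := by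
      rintro ⟨a, b⟩ ⟨c, d⟩ h
      simp only at h
      by_cases hbd : b = d
      · subst hbd
        simpa using h
      · exfalso
        have hbd' : (b : F) - d ≠ 0 := fun h => hbd (Subtype.ext (sub_eq_zero.1 h))
        have : ω = (((c - a) / (b - d) : K) : F) := by
          push_cast
          rw [eq_div_iff hbd']
          linear_combination h
        exact hω (this ▸ Subtype.property _)
    refine ((Nat.bijective_iff_injective_and_card _).2 ⟨hinj, ?_⟩).2
    rw [Nat.card_prod, ← hK, sq]
  refine ⟨?_, ?_⟩
  · intro A
    induction A with
    | h v hv =>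
    choose ab hab using fun i => hdec (v i)
    let a : Fin 3 → K := fun i => (ab i).1
    let b : Fin 3 → K := fun i => (ab i).2
    have hvab : v = coordIncl K a + ω • coordIncl K b := by
      ext i; exact (hab i).symm
    -- `a` and `b` may be proportional, so their span is enlarged to a line, the kernel of a nonzero
    -- functional.
    have hspan : Module.finrank K (Submodule.span K (Set.range ![a, b])) ≤ 2 :=
      (finrank_range_le_card (R := K) ![a, b]).trans_eq (Fintype.card_fin 2)
    obtain ⟨φ, hφ, hle⟩ := exists_le_ker_of_finrank_le_two _ hspan
    obtain ⟨W, hWle, hW⟩ : ∃ W : Submodule K (Fin 3 → K),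
        Submodule.span K (Set.range ![a, b]) ≤ W ∧ Module.finrank K W = 2 :=
      ⟨_, hle, finrank_ker_eq_two hφ⟩
    have h2 := hB W hW
    obtain ⟨P, Q, ⟨hPB, hPW⟩, ⟨hQB, hQW⟩, hPQ⟩ := Set.one_lt_encard_iff.1
      (lt_of_lt_of_le (by norm_num) h2)
    have hWPQ : W = P.submodule ⊔ Q.submodule := by
      have hli := finrank_span_eq_card (Projectivization.linearIndependent_pair_iff_ne.2 hPQ)
      rw [Matrix.range_cons_cons_empty, Submodule.span_insert, ← Projectivization.submodule_eq,
        ← Projectivization.submodule_eq, Fintype.card_fin] at hli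
      exact (Submodule.eq_of_le_of_finrank_eq (sup_le hPW hQW) (hli.trans hW.symm)).symm
    refine ⟨{subplaneIncl K P, subplaneIncl K Q}, ?_, (Set.encard_insert_le _ _).trans (by
      rw [Set.encard_singleton]; norm_num),
      ?_⟩
    · rintro _ (rfl | rfl)
      exacts [⟨P, hPB, rfl⟩, ⟨Q, hQB, rfl⟩]
    have hmem : ∀ w ∈ W, coordIncl K w ∈
        (subplaneIncl K P).submodule ⊔ (subplaneIncl K Q).submodule := by
      induction P with
      | h u hu =>
      induction Q with
      | h u' hu' =>
      intro w hw
      rw [hWPQ, Projectivization.submodule_mk, Projectivization.submodule_mk] at hw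
      obtain ⟨_, hy, _, hz, rfl⟩ := Submodule.mem_sup.1 hw
      obtain ⟨c, rfl⟩ := Submodule.mem_span_singleton.1 hy
      obtain ⟨d, rfl⟩ := Submodule.mem_span_singleton.1 hz
      rw [map_add, map_smulₛₗ, map_smulₛₗ]
      exact Submodule.add_mem_sup
        (Submodule.smul_mem _ _ (Submodule.mem_span_singleton_self _))
        (Submodule.smul_mem _ _ (Submodule.mem_span_singleton_self _))
    rw [iSup_pair, Projectivization.submodule_mk, Submodule.span_singleton_le_iff_mem, hvab]
    exact Submodule.add_mem _ (hmem _ (hWle (Submodule.subset_span (by simp))))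
      (Submodule.smul_mem _ _ (hmem _ (hWle (Submodule.subset_span (by simp)))))
  · intro k hk
    by_contra! hk0
    obtain rfl : k = 0 := by omega
    -- Covering with k = 0 would put (1 : ω : 0) in the subplane, but its coordinate ratio ω is not
    -- in K.
    have hv : (![1, ω, 0] : Fin 3 → F) ≠ 0 := fun h => one_ne_zero (congrFun h 0)
    obtain ⟨T, hTS, hT, hle⟩ := hk (Projectivization.mk F _ hv)
    rw [zero_add, Nat.cast_one, Set.encard_le_one_iff_eq] at hT
    rw [Projectivization.submodule_mk, Submodule.span_singleton_le_iff_mem] at hle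
    obtain rfl | ⟨P, rfl⟩ := hT
    · simp at hle
    · obtain ⟨Q, -, rfl⟩ := hTS rfl
      rw [iSup_singleton] at hle
      induction Q with
      | h u hu =>
      obtain ⟨c, hc⟩ := Submodule.mem_span_singleton.1 hle
      have h0 : c * (u 0 : F) = 1 := congrFun hc 0
      have h1 : c * (u 1 : F) = ω := congrFun hc 1
      have hu0 : (u 0 : F) ≠ 0 := fun h => by simp [h] at h0
      refine hω ?_
      have : ω = ((u 1 / u 0 : K) : F) := by
        push_cast
        rw [eq_div_iff hu0]
        linear_combination (-(u 0 : F)) * h1 + (u 1 : F) * h0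
      exact this ▸ Subtype.property _

/-! ### The Frobenius construction -/

/-- The collineation `(X : Y : Z) ↦ (aX : bZ : cY + dZ)`. -/
def swapShear {K : Type*} [Field K] (a b c d : K) : (Fin 3 → K) →ₗ[K] (Fin 3 → K) where
  toFun v := ![a * v 0, b * v 2, c * v 1 + d * v 2]
  map_add' v w := by ext i; fin_cases i <;> simp <;> ring
  map_smul' t v := by ext i; fin_cases i <;> simp <;> ring

theorem swapShear_injective {K : Type*} [Field K] {a b c d : K} (ha : a ≠ 0) (hb : b ≠ 0)
    (hc : c ≠ 0) : Function.Injective (swapShear a b c d) := by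
  rw [injective_iff_map_eq_zero]
  intro v hv
  have h0 : a * v 0 = 0 := congrFun hv 0
  have h1 : b * v 2 = 0 := congrFun hv 1
  have h2 : c * v 1 + d * v 2 = 0 := congrFun hv 2
  have h2' : v 2 = 0 := (mul_eq_zero.1 h1).resolve_left hb
  rw [h2', mul_zero, add_zero] at h2
  ext i
  fin_cases i
  exacts [(mul_eq_zero.1 h0).resolve_left ha, (mul_eq_zero.1 h2).resolve_left hc, h2']

theorem ncard_range_units_pow {K : Type*} [Field K] [Finite K] {m : ℕ}
    (hm : m ∣ Nat.card K - 1) :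
    (Set.range fun x : Kˣ => x ^ m).ncard * m = Nat.card K - 1 := by
  have h := IsCyclic.card_powMonoidHom_range (G := Kˣ) m
  rw [Nat.card_units, Nat.gcd_eq_right hm] at h
  rw [← Nat.div_mul_cancel hm, ← h]
  rfl

/-- A Hermite-type criterion: `x ↦ x⁻¹ + w x ^ (r - 2)` does not permute the nonzero elements. -/
theorem exists_forall_mul_ne {K : Type*} [Field K] [Finite K] {p j : ℕ} [Fact p.Prime] [CharP K p]
    (hj : j ≠ 0) (hcard : (p ^ j) ^ 2 ≤ Nat.card K) {w : K} (hw : w ≠ 0)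
    (hw' : ∀ x : Kˣ, 1 + w * (x : K) ^ (p ^ j - 1) ≠ 0) :
    ∃ z : Kˣ, ∀ x : Kˣ, (z : K) * x ≠ 1 + w * (x : K) ^ (p ^ j - 1) := by
  classical
  have := Fintype.ofFinite K
  rw [Nat.card_eq_fintype_card] at hcard
  have hr2 : 2 ≤ p ^ j := (Fact.out : p.Prime).two_le.trans (Nat.le_self_pow hj p)
  have hr0 : ((p ^ j : ℕ) : K) = 0 := by
    rw [Nat.cast_pow, CharP.cast_eq_zero, zero_pow hj]
  obtain ⟨m, hm⟩ : ∃ m, p ^ j = m + 1 := ⟨p ^ j - 1, by omega⟩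
  rw [hm] at hr0 hcard hw' hr2 ⊢
  simp only [Nat.add_sub_cancel] at hw' ⊢
  have hmK : m + 1 ≤ Fintype.card K := (Nat.le_self_pow two_ne_zero _).trans hcard
  obtain ⟨d, hd⟩ : ∃ d, Fintype.card K - 1 = d + m := ⟨Fintype.card K - 1 - m, by omega⟩
  have hdm : m * m + m ≤ d := by
    have : Fintype.card K = d + m + 1 := by have := Fintype.card_pos (α := K); omega
    nlinarith
  by_contra! hsurj
  let H : Kˣ → Kˣ := fun x => Units.mk0 _ (hw' x) * x⁻¹
  have hH : Function.Surjective H := fun z => by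
    obtain ⟨x, hx⟩ := hsurj z
    refine ⟨x, ?_⟩
    rw [mul_inv_eq_iff_eq_mul]
    ext
    exact hx.symm
  have hbij := hH.bijective_of_finite
  -- If `H` permuted Kˣ, its m-th power sum would be that of the identity, which vanishes because 0
  -- < m < |K| - 1.
  have h1 : ∑ x : Kˣ, ((H x : Kˣ) : K) ^ m = 0 := by
    refine ((Equiv.ofBijective H hbij).sum_comp fun x : Kˣ => (x : K) ^ m).trans ?_
    rw [FiniteField.sum_pow_units, if_neg]
    intro h
    have := Nat.le_of_dvd (by omega) h
    nlinarith
  have h2 : ∀ x : Kˣ, ((H x : Kˣ) : K) ^ m =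
      ∑ i ∈ Finset.range (m + 1), (w ^ i * (m.choose i : K)) * (x : K) ^ (d + m * i) := by
    intro x
    have hx : ((x : K) ^ m)⁻¹ = (x : K) ^ d := by
      symm
      refine eq_inv_of_mul_eq_one_left ?_
      rw [← pow_add, ← hd]
      exact FiniteField.pow_card_sub_one_eq_one _ x.ne_zero
    have : ((H x : Kˣ) : K) = (w * (x : K) ^ m + 1) * (x : K)⁻¹ := by
      simp [H, add_comm]
    rw [this, mul_pow, inv_pow, hx, add_pow, Finset.sum_mul]
    refine Finset.sum_congr rfl fun i _ => ?_
    ring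
  simp_rw [h2] at h1
  rw [Finset.sum_comm] at h1
  simp_rw [← Finset.mul_sum, FiniteField.sum_pow_units] at h1
  -- Among the exponents d + m i with 0 ≤ i ≤ m, only i = 1 gives a multiple of |K| - 1 = d + m,
  -- since m² + m ≤ d. The surviving coefficient m w equals -w, which is nonzero.
  rw [Finset.sum_eq_single_of_mem 1 (by simp; omega)] at h1
  · rw [mul_one, hd, if_pos dvd_rfl, pow_one, Nat.choose_one_right] at h1
    have hm1 : (m : K) = -1 := by
      push_cast at hr0
      exact eq_neg_of_add_eq_zero_left hr0
    rw [hm1] at h1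
    simp [hw] at h1
  · intro i hi hi1
    rw [if_neg, mul_zero]
    rw [hd]
    rintro ⟨c, hc⟩
    have him : i ≤ m := by simpa [Nat.lt_succ_iff] using hi
    have him' : m * i ≤ m * m := Nat.mul_le_mul_left _ him
    rcases Nat.lt_or_ge c 2 with hc2 | hc2
    · interval_cases c
      · nlinarith
      · rw [mul_one] at hc
        exact hi1 (Nat.eq_of_mul_eq_mul_left (show 0 < m by omega) (by omega))
    · nlinarith [Nat.mul_le_mul_left (d + m) hc2]

/-- These inequalities are what disjointness of the Frobenius set from its `swapShear` image
requires. With r = p^j > 2 and c = 1, both sides are r-th powers; taking r-th roots leaves the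
non-surjectivity of `exists_forall_mul_ne` and the existence of a non-(r - 1)-th power. -/
theorem exists_swapShear_parameters {K : Type*} [Field K] [Finite K] {p j n : ℕ} [Fact p.Prime]
    [CharP K p] (hj : j ≠ 0) (hn : 2 ≤ n) (hcard : Nat.card K = (p ^ j) ^ n) :
    ∃ β c : K, β ≠ 0 ∧ ∀ u : K, u ≠ 0 →
      β * (u ^ (p ^ j - 1)) ^ p ^ j + c ≠ u ^ p ^ j ∧ β * (u ^ (p ^ j - 1)) ^ p ^ j + c ≠ 0 := by
  have hr2 : 2 ≤ p ^ j := (Fact.out : p.Prime).two_le.trans (Nat.le_self_pow hj p)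
  have hcard2 : (p ^ j) ^ 2 ≤ Nat.card K := hcard ▸ Nat.pow_le_pow_right (by omega) hn
  -- For r = 2 every element is an (r - 1)-th power, so this case is separate: c = 0 and any β
  -- outside {0, 1} work.
  rcases hr2.eq_or_lt with h2 | h3
  · rw [← h2] at hcard2 ⊢
    obtain ⟨β, hβ⟩ : ∃ β : K, β ∉ ({0, 1} : Set K) := by
      by_contra! h
      have h1 := Set.ncard_insert_le (0 : K) {1}
      rw [Set.eq_univ_of_forall h, Set.ncard_univ, Set.ncard_singleton] at h1
      omega
    simp only [Set.mem_insert_iff, Set.mem_singleton_iff, not_or] at hβ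
    refine ⟨β, 0, hβ.1, fun u hu => ⟨?_, ?_⟩⟩
    · simp [hu, hβ.2]
    · simp [hu, hβ.1]
  · obtain ⟨v, hv⟩ : ∃ v : Kˣ, v ∉ Set.range fun x : Kˣ => x ^ (p ^ j - 1) := by
      by_contra! h
      have hc := ncard_range_units_pow (K := K) (m := p ^ j - 1)
        (hcard ▸ by simpa using Nat.sub_dvd_pow_sub_pow (p ^ j) 1 n)
      rw [Set.eq_univ_of_forall h, Set.ncard_univ, Nat.card_units] at hc
      have : 0 < Nat.card K - 1 := by have := Finite.one_lt_card (α := K); omega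
      have := Nat.eq_of_mul_eq_mul_left this (hc.trans (mul_one _).symm)
      omega
    have hw : ∀ x : Kˣ, 1 + -(v : K) * (x : K) ^ (p ^ j - 1) ≠ 0 := by
      intro x h
      refine hv ?_
      refine ⟨x⁻¹, ?_⟩
      have : v * x ^ (p ^ j - 1) = 1 := by
        ext
        push_cast
        linear_combination -h
      simpa only [inv_pow] using (eq_inv_of_mul_eq_one_left this).symm
    obtain ⟨z, hz⟩ := exists_forall_mul_ne hj hcard2 (neg_ne_zero.2 v.ne_zero) hw
    -- The factor z^(1 - r) comes from the substitution u = z x, which turns u = 1 - v z^(1 - r)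
    -- u^(r - 1) into z x = 1 - v x^(r - 1).
    refine ⟨(-(v * (z ^ (p ^ j - 1))⁻¹ : Kˣ) : K) ^ p ^ j, 1, by simp, fun u hu => ?_⟩
    have hfr : (-(v * (z ^ (p ^ j - 1))⁻¹ : Kˣ) : K) ^ p ^ j * (u ^ (p ^ j - 1)) ^ p ^ j + 1 =
        (-(v * (z ^ (p ^ j - 1))⁻¹ : Kˣ) * u ^ (p ^ j - 1) + 1) ^ p ^ j := by
      rw [add_pow_char_pow, mul_pow, one_pow]
    rw [hfr]
    refine ⟨fun h => ?_, fun h => ?_⟩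
    · have h' := iterateFrobenius_inj K p j h
      apply hz (Units.mk0 u hu * z⁻¹)
      have hz0 := z.ne_zero
      push_cast at h' ⊢
      rw [mul_pow, inv_pow]
      simp only [Units.val_mk0]
      rw [mul_comm (z : K), mul_assoc, inv_mul_cancel₀ hz0, mul_one]
      linear_combination -h'
    · have h' := pow_eq_zero_iff (by omega) |>.1 h
      refine hv ⟨z * (Units.mk0 u hu)⁻¹, ?_⟩
      ext
      have hu' : u ^ (p ^ j - 1) ≠ 0 := pow_ne_zero _ hu
      have hz' : (z : K) ^ (p ^ j - 1) ≠ 0 := pow_ne_zero _ z.ne_zero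
      push_cast at h' ⊢
      simp only [Units.val_mk0]
      rw [mul_pow, inv_pow]
      field_simp at h' ⊢
      linear_combination h'

/-- The additive function `x ↦ x ^ (p ^ j)`. -/
def frobAddHom (K : Type*) [Field K] (p j : ℕ) [Fact p.Prime] [CharP K p] : K →+ K :=
  (iterateFrobenius K p j).toAddMonoidHom

theorem frobAddHom_apply {K : Type*} [Field K] {p j : ℕ} [Fact p.Prime] [CharP K p] (x : K) :
    frobAddHom K p j x = x ^ p ^ j := rfl

theorem exists_doubleBlocking_of_subfield_card {K : Type*} [Field K] [Finite K] {p j n : ℕ}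
    [Fact p.Prime] [CharP K p] (hj : j ≠ 0) (hn : 2 ≤ n) (hcard : Nat.card K = (p ^ j) ^ n) :
    ∃ B : Set (ℙ K (Fin 3 → K)), IsDoubleBlocking B ∧ ∃ e : ℕ,
      e * (p ^ j - 1) = Nat.card K - 1 ∧ B.ncard = 2 * (Nat.card K + e) := by
  have hr2 : 2 ≤ p ^ j := (Fact.out : p.Prime).two_le.trans (Nat.le_self_pow hj p)
  obtain ⟨β, c, hβ, h⟩ := exists_swapShear_parameters hj hn hcard
  have hM := swapShear_injective (d := c) one_ne_zero one_ne_zero hβ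
  have hsucc : ∀ x : K, x ^ p ^ j = x * x ^ (p ^ j - 1) := fun x => by
    rw [← pow_succ', Nat.sub_add_cancel (by omega)]
  have hd : Disjoint (redeiSet (frobAddHom K p j))
      (Projectivization.map (swapShear 1 1 β c) hM '' redeiSet (frobAddHom K p j)) := by
    rw [Set.disjoint_left]
    -- With u = x⁻¹, a common point lying over an affine point y of the second copy has t = u^r and
    -- y = u^(r - 1). Its last coordinate β y^r + c is then u^r or 0, as the point is affine or a
    -- direction in the first copy.
    have hinv : ∀ t x y : K, t * x = y → t * x ^ p ^ j = 1 →
        x⁻¹ ≠ 0 ∧ t = x⁻¹ ^ p ^ j ∧ y = x⁻¹ ^ (p ^ j - 1) := by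
      intro t x y h0 h1
      have hx : x ≠ 0 := by
        rintro rfl
        rw [zero_pow (by omega), mul_zero] at h1
        exact zero_ne_one h1
      refine ⟨inv_ne_zero hx, ?_, ?_⟩
      · rw [inv_pow, eq_inv_of_mul_eq_one_left h1]
      · rw [hsucc, ← mul_assoc, h0] at h1
        rw [inv_pow, eq_inv_of_mul_eq_one_left h1]
    rintro P (⟨x, rfl⟩ | ⟨x, rfl⟩) ⟨_, ⟨y, rfl⟩ | ⟨y, rfl⟩, hxy⟩ <;>
      obtain ⟨t, ht⟩ := (Projectivization.mk_eq_mk_iff' K _ _ _ _).1 hxy.symm <;>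
      have ht' := (Projectivization.mk_eq_mk_iff' K _ _ _ _).1 hxy
    · obtain ⟨t, ht⟩ := ht'
      have h0 : t * x = 1 * y := congrFun ht 0
      have h1 : t * x ^ p ^ j = 1 * 1 := congrFun ht 1
      have h2 : t * 1 = β * y ^ p ^ j + c * 1 := congrFun ht 2
      rw [one_mul] at h0
      rw [mul_one] at h1 h2
      obtain ⟨hx, h3, rfl⟩ := hinv t x y h0 h1
      exact (h _ hx).1 (by rw [← h3, h2, mul_one])
    · have h0 : t * (1 * (y : K)) = x := congrFun ht 0
      have h1 : t * (1 * 0) = x ^ p ^ j := congrFun ht 1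
      have h2 : t * (β * y ^ p ^ j + c * 0) = 1 := congrFun ht 2
      rw [mul_zero, mul_zero] at h1
      have hx : x = 0 := (pow_eq_zero_iff (by omega)).1 h1.symm
      rw [hx, one_mul, mul_eq_zero, or_iff_left y.ne_zero] at h0
      rw [h0, zero_mul] at h2
      exact zero_ne_one h2
    · obtain ⟨t, ht⟩ := ht'
      have h0 : t * x = 1 * y := congrFun ht 0
      have h1 : t * (x : K) ^ p ^ j = 1 * 1 := congrFun ht 1
      have h2 : t * 0 = β * y ^ p ^ j + c * 1 := congrFun ht 2
      rw [one_mul] at h0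
      rw [mul_one] at h1
      obtain ⟨hx, -, rfl⟩ := hinv t x y h0 h1
      exact (h _ hx).2 (by rw [← mul_one c, ← h2, mul_zero])
    · have h1 : t * (1 * 0) = (x : K) ^ p ^ j := congrFun ht 1
      rw [mul_zero, mul_zero] at h1
      exact pow_ne_zero _ x.ne_zero h1.symm
  refine ⟨_, isDoubleBlocking_redeiSet_union _ _ hM hd, _, ?_, ncard_redeiSet_union _ _ hM hd⟩
  rw [← ncard_range_units_pow (K := K) (m := p ^ j - 1)
        (hcard ▸ by simpa using Nat.sub_dvd_pow_sub_pow (p ^ j) 1 n),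
    ← Set.ncard_image_of_injective (Set.range fun x : Kˣ => x ^ (p ^ j - 1)) Units.val_injective,
    ← Set.range_comp]
  congr 3
  ext x
  simp [frobAddHom_apply, hsucc]

/-! ### The trace construction -/

/-- The collineation `(X : Y : Z) ↦ (dZ : eX : Y - tZ)`. -/
def cycleShear {K : Type*} [Field K] (d e t : K) : (Fin 3 → K) →ₗ[K] (Fin 3 → K) where
  toFun v := ![d * v 2, e * v 0, v 1 - t * v 2]
  map_add' v w := by ext i; fin_cases i <;> simp <;> ring
  map_smul' s v := by ext i; fin_cases i <;> simp <;> ring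

theorem cycleShear_injective {K : Type*} [Field K] {d e : K} (t : K) (hd : d ≠ 0) (he : e ≠ 0) :
    Function.Injective (cycleShear d e t) := by
  rw [injective_iff_map_eq_zero]
  intro v hv
  have h0 : d * v 2 = 0 := congrFun hv 0
  have h1 : e * v 0 = 0 := congrFun hv 1
  have h2 : v 1 - t * v 2 = 0 := congrFun hv 2
  have h2' : v 2 = 0 := (mul_eq_zero.1 h0).resolve_left hd
  rw [h2', mul_zero, sub_zero] at h2
  ext i
  fin_cases i
  exacts [(mul_eq_zero.1 h1).resolve_left he, h2, h2']

section Trace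

variable {k K : Type*} [Field k] [Field K] [Algebra k K]

variable (k K) in
/-- The trace to the subfield `k`, as an additive endofunction. -/
noncomputable def traceAddHom : K →+ K :=
  (algebraMap k K).toAddMonoidHom.comp (Algebra.trace k K).toAddMonoidHom

theorem traceAddHom_apply (x : K) :
    traceAddHom k K x = algebraMap k K (Algebra.trace k K x) := rfl

variable [Finite K]

theorem exists_trace_mul_ne_zero {a : K} (ha : a ≠ 0) : ∃ b : K, Algebra.trace k K (a * b) ≠ 0 := by
  have : Finite k := Finite.of_injective _ (algebraMap k K).injective
  have : Module.Finite k K := Module.Finite.of_finite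
  by_contra! h
  exact ha ((traceForm_nondegenerate k K).1 a fun b => by rw [Algebra.traceForm_apply, h])

theorem exists_trace_eq_one : ∃ t : K, Algebra.trace k K t = 1 := by
  obtain ⟨b, hb⟩ := exists_trace_mul_ne_zero (k := k) (one_ne_zero (α := K))
  rw [one_mul] at hb
  refine ⟨(Algebra.trace k K b)⁻¹ • b, ?_⟩
  rw [map_smul, smul_eq_mul, inv_mul_cancel₀ hb]

/-- If Tr(θ ·) vanished on the kernel of Tr, it would be a scalar multiple of Tr, and nondegeneracy
of the trace form would force θ into k. Rescaling η then gives the value -1. -/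
theorem exists_trace_eq_zero_of_notMem_range {θ : K} (hθ : θ ∉ Set.range (algebraMap k K)) :
    ∃ η : K, Algebra.trace k K η = 0 ∧ Algebra.trace k K (θ * η) = -1 := by
  obtain ⟨t, ht⟩ := exists_trace_eq_one (k := k) (K := K)
  by_cases h : ∀ η : K, Algebra.trace k K η = 0 → Algebra.trace k K (θ * η) = 0
  · exfalso
    refine hθ ⟨Algebra.trace k K (θ * t), ?_⟩
    by_contra hne
    obtain ⟨b, hb⟩ := exists_trace_mul_ne_zero (k := k) (sub_ne_zero.2 hne)
    apply hb
    have h1 := h (b - Algebra.trace k K b • t) (by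
      rw [map_sub, map_smul, ht, smul_eq_mul, mul_one, sub_self])
    rw [mul_sub, mul_smul_comm, map_sub, map_smul, sub_eq_zero, smul_eq_mul] at h1
    rw [sub_mul, map_sub, h1, ← Algebra.smul_def, map_smul, smul_eq_mul, mul_comm, sub_self]
  · push Not at h
    obtain ⟨η, hη, h'⟩ := h
    refine ⟨-(Algebra.trace k K (θ * η))⁻¹ • η, ?_, ?_⟩
    · rw [map_smul, hη, smul_zero]
    · rw [mul_smul_comm, map_smul, smul_eq_mul, neg_mul, inv_mul_cancel₀ h']

/-- A map `a ↦ Tr (δ / (a - θ))` on the ground field without fixed points. -/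
theorem exists_trace_div_ne (h : ∃ θ : K, θ ∉ Set.range (algebraMap k K)) :
    ∃ δ θ : K, δ ≠ 0 ∧ θ ∉ Set.range (algebraMap k K) ∧
      ∀ a : k, Algebra.trace k K (δ / (algebraMap k K a - θ)) ≠ a := by
  have : Finite k := Finite.of_injective _ (algebraMap k K).injective
  obtain ⟨θ, hθ⟩ := h
  have hne : ∀ a : k, algebraMap k K a - θ ≠ 0 := fun a h => hθ ⟨a, sub_eq_zero.1 h⟩
  have hinv : (algebraMap k K 1 - θ)⁻¹ - (algebraMap k K 0 - θ)⁻¹ ≠ 0 := by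
    rw [sub_ne_zero, Ne, inv_inj]
    simp
  obtain ⟨δ, hδ⟩ := exists_trace_mul_ne_zero (k := k) hinv
  let g : k → k := fun a => Algebra.trace k K (δ / (algebraMap k K a - θ))
  have hg : g 1 - g 0 ≠ 0 := by
    rw [sub_mul, map_sub] at hδ
    simpa only [g, div_eq_inv_mul] using hδ
  have hδ0 : δ ≠ 0 := by
    rintro rfl
    simp at hδ
  obtain ⟨κ, hκ⟩ : ∃ κ, κ = g 1 - g 0 := ⟨_, rfl⟩
  rw [← hκ] at hg
  -- κ is chosen so that this map agrees at 0 and 1, hence misses some ρ. The affine change a = ρ +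
  -- κ a' of the variable turns g(a') - κ a' ≠ ρ into the absence of fixed points.
  have hsurj : ¬ Function.Surjective fun a => g a - κ * a := fun hs => by
    have hi := Finite.injective_iff_surjective.2 hs
    refine zero_ne_one (hi (?_ : g 0 - κ * 0 = g 1 - κ * 1))
    rw [hκ]
    ring
  simp only [Function.Surjective] at hsurj
  push Not at hsurj
  obtain ⟨ρ, hρ⟩ := hsurj
  have hκ' : algebraMap k K κ ≠ 0 := by simpa using hg
  refine ⟨algebraMap k K κ * δ, algebraMap k K ρ + algebraMap k K κ * θ, mul_ne_zero hκ' hδ0,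
    ?_, ?_⟩
  · rintro ⟨a, ha⟩
    refine hθ ⟨(a - ρ) / κ, ?_⟩
    rw [map_div₀, map_sub, div_eq_iff hκ']
    linear_combination ha
  · intro a ha
    apply hρ ((a - ρ) / κ)
    have : algebraMap k K κ * δ / (algebraMap k K a - (algebraMap k K ρ + algebraMap k K κ * θ)) =
        δ / (algebraMap k K ((a - ρ) / κ) - θ) := by
      have h1 : algebraMap k K a - (algebraMap k K ρ + algebraMap k K κ * θ) =
          algebraMap k K κ * (algebraMap k K ((a - ρ) / κ) - θ) := by
        rw [map_div₀, map_sub]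
        field_simp
        ring
      rw [h1, mul_div_mul_left _ _ hκ']
    rw [this] at ha
    simp only [g]
    rw [ha]
    field_simp
    ring

theorem ncard_trace_eq_one_mul :
    {x : K | Algebra.trace k K x = 1}.ncard * Nat.card k = Nat.card K := by
  obtain ⟨t, ht⟩ := exists_trace_eq_one (k := k) (K := K)
  have h1 : {x : K | Algebra.trace k K x = 1} =
      (fun x => x + t) '' ((Algebra.trace k K).toAddMonoidHom.ker : Set K) := by
    ext x
    constructor
    · intro hx
      refine ⟨x - t, ?_, sub_add_cancel _ _⟩
      change Algebra.trace k K (x - t) = 0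
      rw [map_sub, ht, hx, sub_self]
    · rintro ⟨y, hy, rfl⟩
      change Algebra.trace k K (y + t) = 1
      rw [map_add, ht, show Algebra.trace k K y = 0 from hy, zero_add]
  have h2 : Function.Surjective (Algebra.trace k K).toAddMonoidHom := fun a =>
    ⟨a • t, by change Algebra.trace k K (a • t) = a; rw [map_smul, ht, smul_eq_mul, mul_one]⟩
  rw [h1, Set.ncard_image_of_injective _ (add_left_injective t),
    ← AddSubgroup.card_mul_index (Algebra.trace k K).toAddMonoidHom.ker, AddSubgroup.index_ker,
    AddMonoidHom.range_eq_top.2 h2, AddSubgroup.card_top]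
  rfl

/-- The ratio Tr(x)/x is invariant under scaling x by kˣ. If Tr(x) ≠ 0, normalise to Tr(x) = 1 and
get x⁻¹; the kernel of the trace, nonzero since |k| < |K|, contributes the extra value 0. -/
theorem ncard_trace_directions (h : Nat.card k < Nat.card K) :
    (Set.range fun x : Kˣ => traceAddHom k K x / (x : K)).ncard =
      {x : K | Algebra.trace k K x = 1}.ncard + 1 := by
  have : Finite k := Finite.of_injective _ (algebraMap k K).injective
  have hrange : (Set.range fun x : Kˣ => traceAddHom k K x / (x : K)) =
      insert 0 ((fun x => x⁻¹) '' {x : K | Algebra.trace k K x = 1}) := by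
    ext m
    constructor
    · rintro ⟨x, rfl⟩
      by_cases hx : Algebra.trace k K (x : K) = 0
      · left
        simp [traceAddHom_apply, hx]
      · right
        refine ⟨(Algebra.trace k K (x : K))⁻¹ • (x : K), ?_, ?_⟩
        · change Algebra.trace k K _ = 1
          rw [map_smul, smul_eq_mul, inv_mul_cancel₀ hx]
        · simp [Algebra.smul_def, traceAddHom_apply, div_eq_mul_inv, mul_comm]
    · rintro (rfl | ⟨x, hx, rfl⟩)
      · have hninj : ¬ Function.Injective (Algebra.trace k K) := fun hi =>
          absurd (Nat.card_le_card_of_injective _ hi) (by omega)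
        rw [injective_iff_map_eq_zero] at hninj
        push Not at hninj
        obtain ⟨x, hx, hx0⟩ := hninj
        exact ⟨Units.mk0 x hx0, by simp [traceAddHom_apply, hx]⟩
      · have hx0 : x ≠ 0 := by
          rintro rfl
          simp at hx
        refine ⟨Units.mk0 x hx0, ?_⟩
        simp [traceAddHom_apply, show Algebra.trace k K x = 1 from hx]
  rw [hrange, Set.ncard_insert_of_notMem _ (Set.toFinite _),
    Set.ncard_image_of_injective _ inv_injective]
  rintro ⟨x, hx, h0⟩
  rw [inv_eq_zero.1 h0] at hx
  simp at hx

theorem exists_doubleBlocking_of_trace (h : Nat.card k < Nat.card K) :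
    ∃ B : Set (ℙ K (Fin 3 → K)), IsDoubleBlocking B ∧ ∃ e : ℕ,
      e * Nat.card k = Nat.card K ∧ B.ncard = 2 * (Nat.card K + (e + 1)) := by
  have hk : Finite k := Finite.of_injective _ (algebraMap k K).injective
  have hex : ∃ θ : K, θ ∉ Set.range (algebraMap k K) := by
    by_contra! hall
    exact absurd (Nat.card_le_card_of_surjective (algebraMap k K) hall) (by omega)
  obtain ⟨δ, θ, hδ, hθ, hfix⟩ := exists_trace_div_ne hex
  obtain ⟨η, hη, hηθ⟩ := exists_trace_eq_zero_of_notMem_range hθ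
  have hη0 : η ≠ 0 := by
    rintro rfl
    simp at hηθ
  have hne : ∀ a : k, algebraMap k K a - θ ≠ 0 := fun a h => hθ ⟨a, sub_eq_zero.1 h⟩
  have hM := cycleShear_injective θ hδ (inv_ne_zero hη0)
  have hd : Disjoint (redeiSet (traceAddHom k K))
      (Projectivization.map (cycleShear δ η⁻¹ θ) hM '' redeiSet (traceAddHom k K)) := by
    rw [Set.disjoint_left]
    rintro P (⟨x, rfl⟩ | ⟨x, rfl⟩) ⟨_, ⟨y, rfl⟩ | ⟨y, rfl⟩, hxy⟩ <;>
      obtain ⟨t, ht⟩ := (Projectivization.mk_eq_mk_iff' K _ _ _ _).1 hxy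
    · have h0 : t * x = δ * 1 := congrFun ht 0
      have h1 : t * algebraMap k K (Algebra.trace k K x) = η⁻¹ * y := congrFun ht 1
      have h2 : t * 1 = algebraMap k K (Algebra.trace k K y) - θ * 1 := congrFun ht 2
      rw [mul_one, mul_one] at h2
      subst h2
      -- Taking traces here gives Tr y = Tr x by the choice of η. As x = δ / (Tr y - θ), the element
      -- Tr y would be a forbidden fixed point.
      have hy : y = Algebra.trace k K x • (Algebra.trace k K y • η - θ * η) := by
        rw [Algebra.smul_def, Algebra.smul_def]
        field_simp at h1
        linear_combination -h1
      have hxy' : Algebra.trace k K y = Algebra.trace k K x := by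
        conv_lhs => rw [hy]
        rw [map_smul, map_sub, map_smul, hη, hηθ]
        simp
      apply hfix (Algebra.trace k K y)
      conv_rhs => rw [hxy']
      congr 1
      rw [div_eq_iff (hne _)]
      linear_combination -h0
    · have h0 : t * x = δ * 0 := congrFun ht 0
      have h1 : t * algebraMap k K (Algebra.trace k K x) = η⁻¹ * y := congrFun ht 1
      have hy : η⁻¹ * (y : K) ≠ 0 := mul_ne_zero (inv_ne_zero hη0) y.ne_zero
      rw [mul_zero, mul_eq_zero] at h0
      rcases h0 with rfl | rfl
      · exact hy (by rw [← h1, zero_mul])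
      · exact hy (by rw [← h1, map_zero, map_zero, mul_zero])
    · have h2 : t * 0 = algebraMap k K (Algebra.trace k K y) - θ * 1 := congrFun ht 2
      rw [mul_zero, mul_one] at h2
      exact hne _ h2.symm
    · have h0 : t * (x : K) = δ * 0 := congrFun ht 0
      have h1 : t * algebraMap k K (Algebra.trace k K (x : K)) = η⁻¹ * y := congrFun ht 1
      rw [mul_zero, mul_eq_zero, or_iff_left x.ne_zero] at h0
      rw [h0, zero_mul] at h1
      exact mul_ne_zero (inv_ne_zero hη0) y.ne_zero h1.symm
  refine ⟨_, isDoubleBlocking_redeiSet_union _ _ hM hd, _, ncard_trace_eq_one_mul, ?_⟩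
  rw [ncard_redeiSet_union _ _ hM hd, ncard_trace_directions h]

end Trace

/-! ### Subfields of finite fields and the three sizes -/

theorem exists_baer_subfield {F : Type*} [Field F] {p h : ℕ} (hp : p.Prime) (hh : h ≠ 0)
    (hF : Nat.card F = p ^ (2 * h)) :
    Finite F ∧ CharP F p ∧ ∃ K : Subfield F, Nat.card K = p ^ h := by
  have := Fact.mk hp
  have hfin : Finite F := Nat.finite_of_card_ne_zero (hF ▸ pow_ne_zero _ hp.ne_zero)
  have hchar : CharP F p := by
    have := Fintype.ofFinite F
    exact charP_of_card_eq_prime_pow (f := 2 * h) (by rw [Fintype.card_eq_nat_card, hF])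
  refine ⟨hfin, hchar, ?_⟩
  let _ := ZMod.algebra F p
  have hdeg : Module.finrank (ZMod p) F = 2 * h :=
    Nat.pow_right_injective hp.two_le ((FiniteField.pow_finrank_eq_natCard p F).trans hF)
  obtain ⟨f⟩ := FiniteField.nonempty_algHom_of_finrank_dvd (F := ZMod p) (K := GaloisField p h)
    (L := F) (by rw [GaloisField.finrank p hh, hdeg]; exact dvd_mul_left _ _)
  refine ⟨f.toRingHom.fieldRange, ?_⟩
  rw [← GaloisField.card p h hh]
  exact (Nat.card_congr (Equiv.ofInjective f f.injective)).symm

theorem exists_proper_subfield_card_eq_largest {K : Type*} [Field K] [Finite K] {p h : ℕ}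
    [Fact p.Prime] [CharP K p] (hh : 2 ≤ h) (hK : Nat.card K = p ^ h) :
    ∃ j n : ℕ, j ≠ 0 ∧ 2 ≤ n ∧ largestProperSubfieldOrder K = p ^ j ∧
      Nat.card K = (p ^ j) ^ n := by
  have hp1 : 1 < p := (Fact.out : p.Prime).one_lt
  -- The supremum is attained: the orders are bounded by |K|, and the prime field is proper because
  -- h ≥ 2.
  have hmem : largestProperSubfieldOrder K ∈
      {n : ℕ | ∃ L : Subfield K, L ≠ ⊤ ∧ Nat.card L = n} := by
    refine Nat.sSup_mem ⟨_, ⊥, ?_, rfl⟩ ⟨Nat.card K, ?_⟩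
    · intro htop
      have h1 := Subfield.card_bot K p
      rw [htop, Nat.card_congr Subfield.topEquiv.toEquiv, hK] at h1
      have := Nat.pow_right_injective hp1 (h1.trans (pow_one p).symm)
      omega
    · rintro _ ⟨L, -, rfl⟩
      exact Nat.card_le_card_of_injective _ Subtype.val_injective
  obtain ⟨L, hL, hcard⟩ := hmem
  let _ := ZMod.algebra L p
  have hLp := FiniteField.pow_finrank_eq_natCard p L
  have hKL := Module.natCard_eq_pow_finrank (K := L) (V := K)
  refine ⟨Module.finrank (ZMod p) L, Module.finrank L K, Module.finrank_pos.ne', ?_,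
    hcard.symm.trans hLp.symm, by rw [hLp, ← hKL]⟩
  by_contra! hlt
  have hpos : 0 < Module.finrank L K := Module.finrank_pos
  rw [show Module.finrank L K = 1 by omega, pow_one] at hKL
  refine hL (eq_top_iff.2 fun x _ => ?_)
  obtain ⟨y, rfl⟩ := ((Nat.bijective_iff_injective_and_card (Subtype.val : L → K)).2
    ⟨Subtype.val_injective, hKL.symm⟩).2 x
  exact y.2

/-- The size condition `P` may depend on the subfield, because the size in (v) involves its largest
proper subfield. -/
theorem exists_baer_saturating_of_doubleBlocking {F : Type*} [Field F] {p h : ℕ}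
    (hp : p.Prime) (hh : h ≠ 0) (hF : Nat.card F = p ^ (2 * h)) {P : Subfield F → ℕ → Prop}
    (H : ∀ K : Subfield F, Finite K → CharP K p → Nat.card K = p ^ h →
      ∃ B : Set (ℙ K (Fin 3 → K)), IsDoubleBlocking B ∧ P K B.ncard) :
    ∃ K : Subfield F, Nat.card K ^ 2 = p ^ (2 * h) ∧
        ∃ B : Set (ℙ K (Fin 3 → K)), IsDoubleBlocking B ∧
          IsSaturating 1 (subplaneIncl K '' B) ∧ P K (subplaneIncl K '' B).ncard := by
  obtain ⟨hfin, hchar, K, hK⟩ := exists_baer_subfield hp hh hF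
  have hK2 : Nat.card K ^ 2 = p ^ (2 * h) := by rw [hK, ← pow_mul, mul_comm]
  obtain ⟨B, hB, hPB⟩ := H K inferInstance inferInstance hK
  refine ⟨K, hK2, B, hB, hB.isSaturating_image (hK2.trans hF.symm), ?_⟩
  rwa [Set.ncard_image_of_injective _ (subplaneIncl_injective K)]

theorem mainTheorem9 {F : Type*} [Field F] (p q : ℕ) (hp : p.Prime) (hF : Nat.card F = q) :
    (∀ h : ℕ, q = p ^ (6 * h) → p ^ h ≡ 2 [MOD 7] →
      ∃ K : Subfield F, Nat.card K ^ 2 = q ∧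
        ∃ B : Set (ℙ K (Fin 3 → K)), IsDoubleBlocking B ∧
          IsSaturating 1 (subplaneIncl K '' B) ∧
          ((subplaneIncl K '' B).ncard : ℝ) =
            2 * √(q : ℝ) + 2 * (q : ℝ) ^ (1 / 3 : ℝ) + 2 * (q : ℝ) ^ (1 / 6 : ℝ) + 2) ∧
    (∀ h : ℕ, q = p ^ (2 * h) → 2 ≤ h → 3 ≤ p →
      ∃ K : Subfield F, Nat.card K ^ 2 = q ∧
        ∃ B : Set (ℙ K (Fin 3 → K)), IsDoubleBlocking B ∧
          IsSaturating 1 (subplaneIncl K '' B) ∧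
          ((subplaneIncl K '' B).ncard : ℝ) =
            2 * √(q : ℝ) + 2 * ((√(q : ℝ) - 1) / ((largestProperSubfieldOrder K : ℝ) - 1))) ∧
    (∀ h : ℕ, q = p ^ (2 * h) → 2 ≤ h → 7 ≤ p →
      ∃ K : Subfield F, Nat.card K ^ 2 = q ∧
        ∃ B : Set (ℙ K (Fin 3 → K)), IsDoubleBlocking B ∧
          IsSaturating 1 (subplaneIncl K '' B) ∧
          ((subplaneIncl K '' B).ncard : ℝ) =
            2 * √(q : ℝ) + 2 * (√(q : ℝ) / (p : ℝ)) + 2) := by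
  have := Fact.mk hp
  have hp0 : (p : ℝ) ≠ 0 := by exact_mod_cast hp.ne_zero
  have hsqrt : ∀ h : ℕ, √((p ^ (2 * h) : ℕ) : ℝ) = (p : ℝ) ^ h := fun h => by
    rw [mul_comm, pow_mul, Nat.cast_pow, Real.sqrt_sq (by positivity), Nat.cast_pow]
  refine ⟨?_, ?_, ?_⟩
  · rintro h rfl h7
    -- For h = 0 the congruence would say 1 ≡ 2 mod 7.
    have hh : h ≠ 0 := by
      rintro rfl
      rw [pow_zero] at h7
      exact absurd h7 (by decide)
    have hroot : ∀ m : ℕ, m ≠ 0 → ∀ a : ℕ, 6 * h = a * m →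
        ((p ^ (6 * h) : ℕ) : ℝ) ^ (1 / (m : ℝ)) = (p : ℝ) ^ a := fun m hm a ha => by
      rw [ha, pow_mul, Nat.cast_pow, one_div, Real.pow_rpow_inv_natCast (by positivity) hm,
        Nat.cast_pow]
    have h3 := hroot 3 (by norm_num) (2 * h) (by ring)
    have h6 := hroot 6 (by norm_num) h (by ring)
    rw [Nat.cast_ofNat] at h3 h6
    rw [h3, h6]
    rw [show 6 * h = 2 * (3 * h) by ring] at hF ⊢
    rw [hsqrt]
    refine exists_baer_saturating_of_doubleBlocking hp (by omega) hF
      (P := fun _ N => (N : ℝ) = 2 * (p : ℝ) ^ (3 * h) + 2 * p ^ (2 * h) + 2 * p ^ h + 2)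
      fun K _ _ hK => ?_
    have hK' : Nat.card K = (p ^ h) ^ 3 := by rw [hK, ← pow_mul, mul_comm]
    obtain ⟨B, hB, e, he, hN⟩ := exists_doubleBlocking_of_subfield_card hh (by norm_num) hK'
    refine ⟨B, hB, ?_⟩
    have hr : 1 < p ^ h := Nat.one_lt_pow hh hp.one_lt
    -- Here K has order r³ with r = p^h, so the number of directions is (r³ - 1)/(r - 1).
    have he' : e = (p ^ h) ^ 2 + p ^ h + 1 := by
      rw [hK'] at he
      obtain ⟨s, hs⟩ : ∃ s, p ^ h = s + 1 := ⟨p ^ h - 1, by omega⟩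
      rw [hs] at he ⊢
      have h1 : (s + 1) ^ 3 - 1 = ((s + 1) ^ 2 + (s + 1) + 1) * s := by
        rw [Nat.sub_eq_iff_eq_add (Nat.one_le_pow _ _ (by omega))]
        ring
      rw [Nat.add_sub_cancel, h1] at he
      exact Nat.eq_of_mul_eq_mul_right (by omega) he
    rw [hN, hK', he']
    push_cast
    ring
  · rintro h rfl hh -
    rw [hsqrt]
    refine exists_baer_saturating_of_doubleBlocking hp (by omega) hF
      (P := fun K N => (N : ℝ) = 2 * (p : ℝ) ^ h +
        2 * (((p : ℝ) ^ h - 1) / ((largestProperSubfieldOrder K : ℝ) - 1))) fun K _ _ hK => ?_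
    obtain ⟨j, n, hj, hn, hφ, hK'⟩ := exists_proper_subfield_card_eq_largest hh hK
    obtain ⟨B, hB, e, he, hN⟩ := exists_doubleBlocking_of_subfield_card hj hn hK'
    refine ⟨B, hB, ?_⟩
    have hr : 1 < p ^ j := Nat.one_lt_pow hj hp.one_lt
    have hr' : ((p ^ j : ℕ) : ℝ) - 1 ≠ 0 := sub_ne_zero.2 (by exact_mod_cast hr.ne')
    have he' := congrArg (Nat.cast (R := ℝ)) he
    rw [Nat.cast_mul, Nat.cast_sub hr.le, Nat.cast_sub Nat.card_pos, hK, Nat.cast_one,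
      Nat.cast_pow p h] at he'
    rw [hφ, ← he', mul_div_cancel_right₀ _ hr', hN, hK]
    push_cast
    ring
  · rintro h rfl hh -
    rw [hsqrt]
    refine exists_baer_saturating_of_doubleBlocking hp (by omega) hF
      (P := fun _ N => (N : ℝ) = 2 * (p : ℝ) ^ h + 2 * ((p : ℝ) ^ h / p) + 2) fun K _ _ hK => ?_
    let _ := ZMod.algebra K p
    obtain ⟨B, hB, e, he, hN⟩ := exists_doubleBlocking_of_trace (k := ZMod p) (K := K) (by
      rw [Nat.card_zmod, hK]
      exact (pow_one p).symm.trans_lt (Nat.pow_lt_pow_right hp.one_lt (by omega)))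
    refine ⟨B, hB, ?_⟩
    have he' := congrArg (Nat.cast (R := ℝ)) he
    rw [Nat.cast_mul, Nat.card_zmod, hK, Nat.cast_pow] at he'
    rw [← he', mul_div_cancel_right₀ _ hp0, hN, hK, Nat.cast_mul, Nat.cast_add, Nat.cast_pow, ← he']
    push_cast
    ring
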